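/- Let $F$ be an arbitrary field and let $G$ be a torsion-free group (that is, the identity is the only element of $G$ of finite order). For $\alpha=\sum_{x\in G}a_x x$ in the group algebra $F[G]$, write $\mathrm{supp}(\alpha)=\{x\in G: a_x\neq 0\}$. If $\gamma,\delta\in F[G]$ satisfy $|\mathrm{supp}(\gamma)|=3$ and $\gamma\delta=1$, then $|\mathrm{supp}(\delta)|\geq 9$. -/

import Mathlib

/-! Let `s` list the support of `γ` and let `D` be the support of `δ`. In `γδ = 1` every product `s
j * d` other than 1 must cancel, so it arises from a second pair. A pair with product 1 is fixed as
`(i, v)`; any other pair with product 1 has it as partner. This is `AlmostCovered`, after which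
coefficients and the field play no role. `exists_almostCovered` passes to the subgroup generated by
the quotients of the `s j`.

Starting at `v`, any pair other than `(i, v)` has a partner `(s k)⁻¹ * s j * d` in `D`, with two
choices of `k`. If both candidates differ from all points found so far, a new point is forced. A
finite branching search (`le_card_of_search`, `search_path`) forces eight points besides `v`,
provided that reduced alternating words in the `s j` of even length between 2 and 8 are nontrivial.

Up to rotation, inversion and renaming of letters there are 17 such words (`relations`). If one were
trivial, then with `y = s₀⁻¹s₁` and `z = s₀⁻¹s₂` one of four things happens. There is torsion. Or
`G` is abelian, against the existence of two unique products (`not_forall_commute`). Or `G` has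
generators with `t a t⁻¹ = a ^ k`, `k ≠ 1`, hence a nonzero homomorphism to `ℤ`, against
`additive_eq_zero` (`conj_ne_zpow`). Or `G` is a nonabelian quotient of the trefoil group `w² = y³`;
there the same search, run on trefoil normal forms (`TrefoilWord.le_card`), gives nine points
directly. -/

/-- `s` lists three elements, and every product `s j * d` with `d ∈ D`, apart from the one given by
the pair `(i, v)`, arises from a second pair. The quotients of the `s j` generate the group. -/
structure AlmostCovered {G : Type*} [Group G] (s : Fin 3 → G) (D : Finset G) (v : G)
    (i : Fin 3) : Prop where
  injective : Function.Injective s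
  generates : ∀ K : Subgroup G, (∀ a b, (s a)⁻¹ * s b ∈ K) → K = ⊤
  mem : v ∈ D
  partner : ∀ d ∈ D, ∀ j, (j ≠ i ∨ d ≠ v) → ∃ k, k ≠ j ∧ (s k)⁻¹ * s j * d ∈ D

/-! ### Elements of finite order. -/

section TorsionFree

variable {G : Type*} [Group G]

theorem eq_one_of_zpow_eq_one (hG : ∀ g : G, IsOfFinOrder g → g = 1) {g : G} {n : ℤ}
    (hn : n ≠ 0) (h : g ^ n = 1) : g = 1 :=
  hG g (isOfFinOrder_iff_zpow_eq_one.2 ⟨n, hn, h⟩)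

theorem eq_one_of_pow_eq_one (hG : ∀ g : G, IsOfFinOrder g → g = 1) {g : G} {n : ℕ}
    (hn : n ≠ 0) (h : g ^ n = 1) : g = 1 :=
  hG g (isOfFinOrder_iff_pow_eq_one.2 ⟨n, Nat.pos_of_ne_zero hn, h⟩)

/-- The orbit of a point of `A` under powers of `u` stays in a finite set, so two powers coincide.
-/
theorem isOfFinOrder_of_mul_mem (A : Finset G) (hA : A.Nonempty) (u : G)
    (hu : ∀ a ∈ A, u * a ∈ A) : IsOfFinOrder u := by
  obtain ⟨a, ha⟩ := hA
  have hmem : ∀ n : ℕ, u ^ n * a ∈ A := by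
    intro n
    induction n with
    | zero => simpa using ha
    | succ n ih => rw [pow_succ', mul_assoc]; exact hu _ ih
  by_contra h
  have hinj := injective_pow_iff_not_isOfFinOrder.2 h
  have : Function.Injective (fun n : ℕ => (⟨u ^ n * a, hmem n⟩ : A)) := by
    intro m n hmn
    exact hinj (mul_right_cancel (Subtype.ext_iff.1 hmn))
  exact not_injective_infinite_finite _ this

end TorsionFree

/-! ### Homomorphisms to the integers and commutativity. -/

namespace AlmostCovered

variable {G : Type*} [Group G] {s : Fin 3 → G} {D : Finset G} {v : G} {i : Fin 3}

/-- Lets relation words be treated up to renaming of the three letters. -/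
theorem comp_perm (h : AlmostCovered s D v i) (σ : Equiv.Perm (Fin 3)) :
    AlmostCovered (s ∘ σ) D v (σ.symm i) where
  injective := h.injective.comp σ.injective
  generates K hK := h.generates K fun a b => by simpa using hK (σ.symm a) (σ.symm b)
  mem := h.mem
  partner d hd j hj := by
    obtain ⟨k, hk, hkD⟩ := h.partner d hd (σ j) (by
      refine hj.imp_left fun hj hji => hj ?_
      simp [← hji])
    refine ⟨σ.symm k, fun hk' => hk ?_, by simpa using hkD⟩
    simp [← hk']

theorem closure_eq_top (h : AlmostCovered s D v i) :
    Subgroup.closure {(s 0)⁻¹ * s 1, (s 0)⁻¹ * s 2} = ⊤ := by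
  apply h.generates
  have h0 : ∀ a, (s 0)⁻¹ * s a ∈ Subgroup.closure {(s 0)⁻¹ * s 1, (s 0)⁻¹ * s 2} := by
    intro a
    fin_cases a
    · simp
    · exact Subgroup.subset_closure (by simp)
    · exact Subgroup.subset_closure (by simp)
  intro a b
  have := Subgroup.mul_mem _ (Subgroup.inv_mem _ (h0 a)) (h0 b)
  simpa [mul_assoc] using this

/-- An additive function on `s` is maximal at the exceptional index. -/
theorem exceptional_isMax (hG : ∀ g : G, IsOfFinOrder g → g = 1) (h : AlmostCovered s D v i)
    (f : G → ℤ) (hf : ∀ x y, f (x * y) = f x + f y) (a : Fin 3) : f (s a) ≤ f (s i) := by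
  have hf1 : f 1 = 0 := by have := hf 1 1; simp at this; exact this
  have hfinv : ∀ x, f x⁻¹ = - f x := by
    intro x; have := hf x⁻¹ x; rw [inv_mul_cancel, hf1] at this; omega
  obtain ⟨j, -, hj⟩ := Finset.exists_max_image Finset.univ (fun a => f (s a)) ⟨0, by simp⟩
  obtain ⟨d₀, hd₀, hdmax⟩ := Finset.exists_max_image D f ⟨v, h.mem⟩
  simp only [Finset.mem_univ, true_imp_iff] at hj
  by_cases hi : f (s i) = f (s j)
  · rw [hi]; exact hj a
  exfalso
  have hji : ∀ a, f (s a) = f (s j) → a ≠ i := by rintro a ha rfl; exact hi ha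
  -- the partner of a top pair is again a top pair
  have key : ∀ a, f (s a) = f (s j) → ∀ d ∈ D, f d = f d₀ →
      ∃ k, k ≠ a ∧ f (s k) = f (s j) ∧ (s k)⁻¹ * s a * d ∈ D ∧
        f ((s k)⁻¹ * s a * d) = f d₀ := by
    intro a ha d hd hdf
    obtain ⟨k, hk, hkD⟩ := h.partner d hd a (Or.inl (hji a ha))
    have h1 := hdmax _ hkD
    have h2 := hj k
    have h3 : f ((s k)⁻¹ * s a * d) = - f (s k) + f (s a) + f d := by rw [hf, hf, hfinv]
    exact ⟨k, hk, by omega, hkD, by omega⟩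
  obtain ⟨k, hkj, hkf, -, -⟩ := key j rfl d₀ hd₀ rfl
  -- The exceptional index is not maximal, so at most two indices are. The partner of a top pair at
  -- `j` then always has index `k`, and `(s k)⁻¹ * s j` maps the top layer of `D` into itself.
  have huniq : ∀ a, a ≠ j → f (s a) = f (s j) → a = k := by
    intro a haj haf
    have h1 := hji j rfl
    have h2 := hji k hkf
    have h3 := hji a haf
    omega
  have hfin := isOfFinOrder_of_mul_mem (D.filter fun d => f d = f d₀) ⟨d₀, by simp [hd₀]⟩
    ((s k)⁻¹ * s j) (by
      intro a ha
      simp only [Finset.mem_filter] at ha ⊢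
      obtain ⟨k', hk', hkf', hD, hfd⟩ := key j rfl a ha.1 ha.2
      rw [huniq k' hk' hkf'] at hD hfd
      exact ⟨hD, hfd⟩)
  have := hG _ hfin
  exact hkj (h.injective (inv_mul_eq_one.1 this))

/-- By `exceptional_isMax` for `f` and for `-f`, the value at `s i` is both maximal and minimal. So
`f` is constant on `s` and its kernel contains the generating quotients. -/
theorem additive_eq_zero (hG : ∀ g : G, IsOfFinOrder g → g = 1) (h : AlmostCovered s D v i)
    (f : G → ℤ) (hf : ∀ x y, f (x * y) = f x + f y) (x : G) : f x = 0 := by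
  have hf1 : f 1 = 0 := by have := hf 1 1; simp at this; exact this
  have hfinv : ∀ x, f x⁻¹ = - f x := by
    intro x; have := hf x⁻¹ x; rw [inv_mul_cancel, hf1] at this; omega
  have hs : ∀ a b, f (s a) = f (s b) := by
    by_contra! hs
    have h1 := h.exceptional_isMax hG f hf
    have h2 := h.exceptional_isMax hG (fun x => - f x) (fun x y => by rw [hf]; ring)
    obtain ⟨a, b, hab⟩ := hs
    have := h1 a; have := h1 b; have := h2 a; have := h2 b
    omega
  let K : Subgroup G :=
    { carrier := {x | f x = 0}
      mul_mem' := by intro a b ha hb; simp_all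
      one_mem' := hf1
      inv_mem' := by intro a ha; simp_all }
  have hK : K = ⊤ := h.generates K fun a b => by
    change f _ = 0
    rw [hf, hfinv, hs a b]; ring
  have : x ∈ K := hK ▸ Subgroup.mem_top x
  exact this

/-- A finitely generated torsion-free abelian group has two unique products for the image of `s` and
`D`, whereas only the pair `(i, v)` may lack a partner. -/
theorem not_forall_commute (hG : ∀ g : G, IsOfFinOrder g → g = 1) (h : AlmostCovered s D v i) :
    ¬ ∀ x y : G, x * y = y * x := by
  intro hcomm
  classical
  let _ : CommGroup G := { (inferInstance : Group G) with mul_comm := hcomm }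
  have : IsMulTorsionFree G := IsMulTorsionFree.of_not_isOfFinOrder fun x hx hx' => hx (hG x hx')
  have : Group.FG G := Group.fg_iff.2 ⟨_, h.closure_eq_top, by simp⟩
  have : Monoid.FG G := Group.fg_iff_monoid_fg.1 inferInstance
  have hcard : (Finset.univ.image s).card = 3 := by
    rw [Finset.card_image_of_injective _ h.injective]; simp
  have hD : 0 < D.card := Finset.card_pos.2 ⟨v, h.mem⟩
  obtain ⟨p, hp, q, hq, hpq, hpu, hqu⟩ :=
    TwoUniqueProds.uniqueMul_of_one_lt_card (A := Finset.univ.image s) (B := D)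
      (by rw [hcard]; omega)
  have key : ∀ p ∈ Finset.univ.image s ×ˢ D, UniqueMul (Finset.univ.image s) D p.1 p.2 →
      p = (s i, v) := by
    rintro ⟨p₁, p₂⟩ hp hu
    simp only [Finset.mem_product, Finset.mem_image, Finset.mem_univ, true_and] at hp
    obtain ⟨⟨j, rfl⟩, hpD⟩ := hp
    by_contra hne
    obtain ⟨k, hk, hkD⟩ := h.partner p₂ hpD j (by
      by_contra! hcon
      exact hne (by rw [hcon.1, hcon.2]))
    have := hu (a := s k) (by simp) hkD (by simp [mul_assoc])
    exact hk (h.injective this.1)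
  exact hpq ((key p hp hpu).trans (key q hq hqu).symm)

theorem forall_commute_of_generators {t a : G}
    (hgen : Subgroup.closure {t, a} = ⊤) (hta : Commute t a) (x y : G) : x * y = y * x := by
  have hc : ∀ x ∈ ({t, a} : Set G), ∀ y ∈ ({t, a} : Set G), x * y = y * x := by
    rintro x (rfl | rfl) y (rfl | rfl)
    · rfl
    · exact hta
    · exact hta.symm
    · rfl
  have := Subgroup.isMulCommutative_closure hc
  have hx : x ∈ Subgroup.closure {t, a} := hgen ▸ Subgroup.mem_top x
  have hy : y ∈ Subgroup.closure {t, a} := hgen ▸ Subgroup.mem_top y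
  exact congrArg Subtype.val (mul_comm' (⟨x, hx⟩ : Subgroup.closure {t, a}) ⟨y, hy⟩)

/-- Two generators of the group of an almost covered configuration do not commute. -/
theorem not_commute (hG : ∀ g : G, IsOfFinOrder g → g = 1) (h : AlmostCovered s D v i) {t a : G}
    (hgen : Subgroup.closure {t, a} = ⊤) : ¬ Commute t a :=
  fun hta => h.not_forall_commute hG (forall_commute_of_generators hgen hta)

end AlmostCovered

/-! ### Baumslag–Solitar relations. -/

namespace AlmostCovered

variable {G : Type*} [Group G] {s : Fin 3 → G} {D : Finset G} {v : G} {i : Fin 3}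

theorem conj_pow_zpow {t a : G} {k : ℤ} (hk : t * a * t⁻¹ = a ^ k) (m : ℕ) (n : ℤ) :
    t ^ m * a ^ n = a ^ (k ^ m * n) * t ^ m := by
  have h1 : ∀ n : ℤ, t * a ^ n = a ^ (k * n) * t := by
    intro n
    have : (t * a * t⁻¹) ^ n = a ^ (k * n) := by rw [hk, zpow_mul]
    rw [conj_zpow] at this
    rw [← this]; group
  induction m generalizing n with
  | zero => simp
  | succ m ih =>
    rw [pow_succ, mul_assoc, h1, ← mul_assoc, ih, mul_assoc, pow_succ, mul_assoc]

/-- The generators of the group do not satisfy a Baumslag–Solitar relation of type `(1, k)`. -/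
theorem conj_ne_zpow (hG : ∀ g : G, IsOfFinOrder g → g = 1) (h : AlmostCovered s D v i) {t a : G}
    (hgen : Subgroup.closure {t, a} = ⊤) {k : ℤ} (hk1 : k ≠ 1) : t * a * t⁻¹ ≠ a ^ k := by
  intro hk
  have hcomm := h.not_commute hG hgen
  have ht : t ≠ 1 := by rintro rfl; exact hcomm (Commute.one_left a)
  have hmul := fun m n => conj_pow_zpow hk m n
  -- no nontrivial power of `t` is a power of `a`
  have hta : ∀ n q : ℤ, a ^ n = t ^ q → q = 0 := by
    intro n q hnq
    have h1 := hmul 1 n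
    have h2 : a ^ n = a ^ (k * n) := by
      rw [pow_one, pow_one, hnq, ← zpow_one_add, add_comm, zpow_add_one] at h1
      rw [hnq]; exact mul_right_cancel h1
    have h3 : (a ^ n) ^ (k - 1) = 1 := by
      rw [← zpow_mul, mul_sub, mul_one, zpow_sub, mul_comm n, ← h2, mul_inv_cancel]
    have h4 := eq_one_of_zpow_eq_one hG (sub_ne_zero.2 hk1) h3
    by_contra hq
    exact ht (eq_one_of_zpow_eq_one hG hq (hnq ▸ h4))
  -- The level `r` is the exponent sum of `t` in `x`. The factor `t ^ m` is needed because
  -- conjugation by `t`, but perhaps not by `t⁻¹`, maps powers of `a` to powers of `a`. The level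
  -- will be a homomorphism to `ℤ` with value 1 at `t`.
  let Lev : G → ℤ → Prop := fun x r => ∃ m : ℕ, ∃ n : ℤ, t ^ m * x = a ^ n * t ^ ((m : ℤ) + r)
  have hraise : ∀ x r (m : ℕ) (n : ℤ), t ^ m * x = a ^ n * t ^ ((m : ℤ) + r) →
      ∀ l : ℕ, t ^ (l + m) * x = a ^ (k ^ l * n) * t ^ (((l + m : ℕ) : ℤ) + r) := by
    intro x r m n hx l
    rw [pow_add, mul_assoc, hx, ← mul_assoc, hmul, mul_assoc, ← zpow_natCast t l, ← zpow_add]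
    push_cast
    rw [add_assoc]
  have huniq : ∀ x r r', Lev x r → Lev x r' → r = r' := by
    rintro x r r' ⟨m, n, hx⟩ ⟨m', n', hx'⟩
    have h1 := hraise x r m n hx m'
    have h2 := hraise x r' m' n' hx' m
    rw [add_comm m m', h1] at h2
    have h3 : a ^ (k ^ m * n' * (-1) + k ^ m' * n) = t ^ (r' - r) := by
      rw [zpow_add, mul_neg_one, zpow_neg, inv_mul_eq_iff_eq_mul]
      have h4 := eq_mul_inv_of_mul_eq h2
      rw [h4, mul_assoc, ← zpow_neg, ← zpow_add]
      congr 2; ring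
    have := hta _ _ h3
    omega
  have hLa : ∀ x r, Lev x r → ∀ e : ℤ, Lev (a ^ e * x) r := by
    rintro x r ⟨m, n, hx⟩ e
    refine ⟨m, k ^ m * e + n, ?_⟩
    rw [← mul_assoc, hmul, mul_assoc, hx, ← mul_assoc, ← zpow_add]
  have hLt : ∀ x r, Lev x r → Lev (t * x) (r + 1) := by
    rintro x r ⟨m, n, hx⟩
    refine ⟨m, k * n, ?_⟩
    have := hmul 1 n
    simp only [pow_one] at this
    rw [← mul_assoc, ← pow_succ, pow_succ', mul_assoc, hx, ← mul_assoc, this, mul_assoc,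
      ← zpow_one_add]
    congr 2; ring
  have hLt' : ∀ x r, Lev x r → Lev (t⁻¹ * x) (r - 1) := by
    rintro x r ⟨m, n, hx⟩
    refine ⟨m + 1, n, ?_⟩
    rw [pow_succ, mul_assoc, mul_inv_cancel_left, hx]
    congr 2; push_cast; ring
  have hL1 : Lev 1 0 := ⟨0, 0, by simp⟩
  -- left multiplication by `g` shifts the level by a constant
  have hshift : ∀ g : G, ∃ q, ∀ x r, Lev x r → Lev (g * x) (q + r) := by
    intro g
    have hg : g ∈ Subgroup.closure {t, a} := hgen ▸ Subgroup.mem_top g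
    induction hg using Subgroup.closure_induction_left with
    | one => exact ⟨0, fun x r hx => by simpa using hx⟩
    | mul_left g hg y _ ih =>
      obtain ⟨q, hq⟩ := ih
      rcases hg with rfl | rfl
      · exact ⟨q + 1, fun x r hx => by
          have := hLt _ _ (hq x r hx); rw [mul_assoc]; convert this using 1; ring⟩
      · exact ⟨q, fun x r hx => by
          have := hLa _ _ (hq x r hx) 1; rw [mul_assoc]; simpa using this⟩
    | inv_mul_cancel g hg y _ ih =>
      obtain ⟨q, hq⟩ := ih
      rcases hg with rfl | rfl
      · exact ⟨q - 1, fun x r hx => by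
          have := hLt' _ _ (hq x r hx); rw [mul_assoc]; convert this using 1; ring⟩
      · exact ⟨q, fun x r hx => by
          have := hLa _ _ (hq x r hx) (-1); rw [mul_assoc]; simpa using this⟩
  choose f hf using hshift
  have hfL : ∀ g, Lev g (f g) := fun g => by simpa using hf g 1 0 hL1
  have hadd : ∀ x y, f (x * y) = f x + f y := fun x y =>
    huniq _ _ _ (hfL _) (hf x y _ (hfL y))
  have h0 := h.additive_eq_zero hG f hadd t
  have h1 := huniq _ _ _ (hfL t) (by simpa using hLt 1 0 hL1)
  omega

end AlmostCovered

/-! ### Reduction to the subgroup generated by the quotients. -/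

/-- Restriction of an almost covered configuration to the subgroup generated by the quotients. -/
theorem exists_almostCovered {G : Type*} [Group G] {s : Fin 3 → G} (hs : Function.Injective s)
    {D : Finset G} {v : G} {i : Fin 3} (hv : v ∈ D)
    (hp : ∀ d ∈ D, ∀ j, (j ≠ i ∨ d ≠ v) → ∃ k, k ≠ j ∧ (s k)⁻¹ * s j * d ∈ D) :
    ∃ (H : Subgroup G) (s' : Fin 3 → H) (D' : Finset H) (v' : H),
      AlmostCovered s' D' v' i ∧ D'.card ≤ D.card := by
  classical
  let H : Subgroup G := Subgroup.closure (Set.range fun p : Fin 3 × Fin 3 => (s p.1)⁻¹ * s p.2)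
  have hH : ∀ a b, (s a)⁻¹ * s b ∈ H := fun a b => Subgroup.subset_closure ⟨(a, b), rfl⟩
  let s' : Fin 3 → H := fun a => ⟨(s 0)⁻¹ * s a, hH 0 a⟩
  have hs' : ∀ a b, (((s' a)⁻¹ * s' b : H) : G) = (s a)⁻¹ * s b := by
    intro a b; simp [s', mul_assoc]
  -- Partners differ by left factors in `H`, so the coset `H v` can be treated alone; right
  -- translation moves `v` to 1.
  let D' : Finset H := (D.image (· * v⁻¹)).subtype (· ∈ H)
  have hD' : ∀ x : H, x ∈ D' ↔ (x : G) * v ∈ D := by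
    intro x
    simp only [D', Finset.mem_subtype, Finset.mem_image]
    constructor
    · rintro ⟨d, hd, hdx⟩; rw [← hdx]; simpa using hd
    · intro hx; exact ⟨_, hx, by simp⟩
  refine ⟨H, s', D', 1, ⟨?_, ?_, ?_, ?_⟩, ?_⟩
  · intro a b hab
    exact hs (mul_left_cancel (Subtype.ext_iff.1 hab))
  · intro K hK
    have : H ≤ K.map H.subtype := by
      rw [Subgroup.closure_le]
      rintro _ ⟨p, rfl⟩
      exact ⟨_, hK p.1 p.2, hs' p.1 p.2⟩
    rw [eq_top_iff]
    intro x _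
    obtain ⟨y, hy, hyx⟩ := this x.2
    rwa [← Subtype.ext hyx]
  · rw [hD']; simpa using hv
  · intro d hd j hj
    obtain ⟨k, hk, hkD⟩ := hp (d * v) ((hD' d).1 hd) j (by
      refine hj.imp_right fun hd hdv => hd ?_
      exact Subtype.ext (by simpa using hdv))
    refine ⟨k, hk, (hD' _).2 ?_⟩
    rw [Subgroup.coe_mul, hs']
    simpa [mul_assoc] using hkD
  · have : D'.card ≤ (D.image (· * v⁻¹)).card := by
      rw [Finset.card_subtype]; exact Finset.card_filter_le _ _
    exact this.trans Finset.card_image_le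

/-! ### Noncentral elements in torsion-free quotients of the trefoil group. -/

section TrefoilRelations

variable {G : Type*} [Group G] {w y : G}

/-- If `u` is a square root of `c ^ q` and `u * y` a cube root of `c ^ p`, where `c = y ^ 3` is
central, then a commutator computation gives a relation for `c`. -/
theorem central_zpow_eq_one {c u y : G} (hc : ∀ x, Commute c x) (hy : y ^ 3 = c) {p q : ℤ}
    (hu : u ^ 2 = c ^ q) (huy : (u * y) ^ 3 = c ^ p) : c ^ (4 * (p - 1) - 6 * q) = 1 := by
  have hz : ∀ (n : ℤ) x, c ^ n * x = x * c ^ n := fun n x => ((hc x).zpow_left n).eq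
  obtain ⟨u₁, hu₁⟩ : ∃ u₁, u₁ = y * u * y⁻¹ := ⟨_, rfl⟩
  obtain ⟨u₂, hu₂⟩ : ∃ u₂, u₂ = y ^ 2 * u * (y ^ 2)⁻¹ := ⟨_, rfl⟩
  have h1 : u₁ ^ 2 = c ^ q := by rw [hu₁, conj_pow, hu, ← hz, mul_inv_cancel_right]
  have h2 : u₂ ^ 2 = c ^ q := by rw [hu₂, conj_pow, hu, ← hz, mul_inv_cancel_right]
  -- This is `(u y)³ = u u₁ u₂ y³`. It makes `(u u₁)²` a power of `c`, so `u` and `u₁` commute up to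
  -- a power of `c`; squaring that relation removes `u₁`.
  have hprod : u * u₁ = c ^ (p - 1) * u₂⁻¹ := by
    rw [eq_mul_inv_iff_mul_eq, zpow_sub_one, ← huy, ← hy, hu₁, hu₂]
    simp only [pow_succ, pow_zero, one_mul]; group
  have hsq : u * u₁ * (u * u₁) = c ^ (2 * (p - 1) - q) := by
    calc u * u₁ * (u * u₁) = (c ^ (p - 1) * u₂⁻¹) * (c ^ (p - 1) * u₂⁻¹) := by rw [hprod]
      _ = c ^ (p - 1) * c ^ (p - 1) * (u₂ ^ 2)⁻¹ := by
        rw [mul_assoc, ← mul_assoc u₂⁻¹, ← hz (p - 1) u₂⁻¹, pow_two, mul_inv_rev]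
        simp only [mul_assoc]
      _ = _ := by rw [h2, ← zpow_neg, ← zpow_add, ← zpow_add]; congr 1; ring
  have hconj : u * u₁ * u⁻¹ = c ^ (2 * (p - 1) - 3 * q) * u₁ := by
    have e1 : u⁻¹ = c ^ (-q) * u := by
      rw [zpow_neg, ← hu]; group
    have e2 : u₁⁻¹ = c ^ (-q) * u₁ := by
      rw [zpow_neg, ← h1]; group
    calc u * u₁ * u⁻¹ = c ^ (-q) * (u * u₁ * (u * u₁)) * u₁⁻¹ := by
          rw [e1, ← mul_assoc, ← hz]; group
      _ = c ^ (-q) * c ^ (2 * (p - 1) - q) * (c ^ (-q) * u₁) := by rw [hsq, e2]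
      _ = _ := by
        rw [← mul_assoc, ← zpow_add, ← zpow_add]; congr 2; ring
  have hfin : c ^ q = c ^ (2 * (2 * (p - 1) - 3 * q)) * c ^ q := by
    calc c ^ q = (u * u₁ * u⁻¹) ^ 2 := by rw [conj_pow, h1, ← hz, mul_inv_cancel_right]
      _ = _ := by
        rw [hconj, ((hc u₁).zpow_left _).mul_pow, h1, ← zpow_natCast, ← zpow_mul]
        congr 2; push_cast; ring
  have := (mul_eq_right.1 hfin.symm)
  rw [← this]; congr 1; ring

/-- A noncommuting pair in a torsion-free group with `w ^ 2 = y ^ 3` central. -/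
structure TrefoilPair (w y : G) : Prop where
  torsionFree : ∀ g : G, IsOfFinOrder g → g = 1
  sq_eq_cube : w ^ 2 = y ^ 3
  central : ∀ x, Commute (w ^ 2) x
  not_commute : ¬ Commute w y

namespace TrefoilPair

theorem sq_ne_one (h : TrefoilPair w y) : w ^ 2 ≠ 1 := fun hw => h.not_commute (by
  rw [eq_one_of_pow_eq_one h.torsionFree two_ne_zero hw]; exact Commute.one_left y)

theorem inv (h : TrefoilPair w y) : TrefoilPair w⁻¹ y⁻¹ where
  torsionFree := h.torsionFree
  sq_eq_cube := by rw [inv_pow, inv_pow, h.sq_eq_cube]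
  central x := by rw [inv_pow]; exact (h.central x).inv_left
  not_commute hwy := h.not_commute (by simpa using hwy.inv_inv)

theorem zpow_ne_one (h : TrefoilPair w y) {n : ℤ} (hn : n ≠ 0) : (w ^ 2) ^ n ≠ 1 := fun hw =>
  h.sq_ne_one (eq_one_of_zpow_eq_one h.torsionFree hn hw)

theorem left_ne (h : TrefoilPair w y) (k : ℤ) : w ≠ (w ^ 2) ^ k := fun hw =>
  h.not_commute (hw ▸ (h.central y).zpow_left k)

theorem right_ne (h : TrefoilPair w y) (k : ℤ) : y ≠ (w ^ 2) ^ k := fun hy =>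
  h.not_commute (by rw [hy]; exact ((h.central w).zpow_left k).symm)

theorem mul_ne (h : TrefoilPair w y) (k : ℤ) : w * y ≠ (w ^ 2) ^ k := by
  intro hk
  apply h.not_commute
  rw [eq_inv_mul_of_mul_eq hk]
  exact (Commute.refl w).inv_right.mul_right ((h.central w).zpow_left k).symm

/-- Otherwise `w` conjugates `y` to a central multiple of `y⁻¹`. Cubing gives a relation on `w ^ 2`
with exponent `3 (k - 1) - 2`, which is never 0. -/
theorem mul_pow_two_ne (h : TrefoilPair w y) (k : ℤ) : (w * y) ^ 2 ≠ (w ^ 2) ^ k := by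
  intro hk
  have hconj : w * y * w⁻¹ = (w ^ 2) ^ (k - 1) * y⁻¹ := by
    calc w * y * w⁻¹ = (w * y) ^ 2 * (y⁻¹ * (w ^ 2)⁻¹) := by
          simp only [pow_succ, pow_zero, one_mul]; group
      _ = _ := by rw [hk, ← (h.central y⁻¹).inv_left.eq, ← mul_assoc, zpow_sub_one]
  have h3 : (w * y * w⁻¹) ^ 3 = w ^ 2 := by
    rw [conj_pow, ← h.sq_eq_cube, ← (h.central w).eq, mul_inv_cancel_right]
  rw [hconj, ((h.central y⁻¹).zpow_left _).mul_pow, inv_pow, ← h.sq_eq_cube, ← zpow_natCast,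
    ← zpow_mul, ← zpow_sub_one] at h3
  refine h.zpow_ne_one (n := (k - 1) * 3 - 2) (by omega) ?_
  have h4 := mul_inv_eq_one.2 h3
  rw [← zpow_sub_one] at h4
  rw [← h4]; congr 1; push_cast; ring

/-- The exponent `4 (k - 1) - 6` from `central_zpow_eq_one` is 2 modulo 4. -/
theorem mul_pow_three_ne (h : TrefoilPair w y) (k : ℤ) : (w * y) ^ 3 ≠ (w ^ 2) ^ k := fun hk =>
  h.zpow_ne_one (by omega)
    (central_zpow_eq_one h.central h.sq_eq_cube.symm (q := 1) (zpow_one _).symm hk)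

/-- Apply `central_zpow_eq_one` to `u = (w y)²`: then `u y` is a central multiple of a conjugate of
`y⁻¹`, so its cube is central. The resulting exponent `6 k - 20` is nonzero. -/
theorem mul_pow_four_ne (h : TrefoilPair w y) (k : ℤ) : (w * y) ^ 4 ≠ (w ^ 2) ^ k := by
  intro hk
  have hz : ∀ (n : ℤ) x, (w ^ 2) ^ n * x = x * (w ^ 2) ^ n :=
    fun n x => ((h.central x).zpow_left n).eq
  have hu : ((w * y) ^ 2) ^ 2 = (w ^ 2) ^ k := by rw [← pow_mul, ← hk]
  have hconj : (w * y) ^ 2 * y = (w ^ 2) ^ (k - 1) * ((y⁻¹ * w) * y⁻¹ * (y⁻¹ * w)⁻¹) := by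
    calc (w * y) ^ 2 * y = (w * y) ^ 4 * (y⁻¹ * ((w ^ 2)⁻¹ * (w * y⁻¹ * w⁻¹ * y))) := by
          simp only [pow_succ, pow_zero, one_mul]; group
      _ = (w ^ 2) ^ k * ((w ^ 2)⁻¹ * (y⁻¹ * (w * y⁻¹ * w⁻¹ * y))) := by
          rw [hk, ← mul_assoc y⁻¹, ← (h.central y⁻¹).inv_left.eq, mul_assoc (w ^ 2)⁻¹]
      _ = _ := by rw [zpow_sub_one, mul_assoc]; simp only [mul_assoc, mul_inv_rev, inv_inv]
  have hcube : ((w * y) ^ 2 * y) ^ 3 = (w ^ 2) ^ (3 * k - 4) := by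
    rw [hconj, ((h.central _).zpow_left _).mul_pow, conj_pow, inv_pow, ← h.sq_eq_cube,
      ← (h.central _).inv_left.eq, mul_inv_cancel_right, ← zpow_natCast, ← zpow_mul,
      ← zpow_sub_one]
    congr 1; push_cast; ring
  exact h.zpow_ne_one (by omega) (central_zpow_eq_one h.central h.sq_eq_cube.symm hu hcube)

/-- Otherwise `y` is a power of `w y` up to a central factor, so it commutes with `w y` and hence
with `w`. -/
theorem mul_pow_mul_ne (h : TrefoilPair w y) (m : ℕ) (k : ℤ) : (w * y) ^ m * y ≠ (w ^ 2) ^ k := by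
  intro hk
  have hy : y = ((w * y) ^ m)⁻¹ * (w ^ 2) ^ k := eq_inv_mul_of_mul_eq hk
  have h1 : Commute (w * y) y := by
    conv_rhs => rw [hy]
    exact ((Commute.refl (w * y)).pow_right m).inv_right.mul_right
      ((h.central (w * y)).zpow_left k).symm
  apply h.not_commute
  have := h1.mul_left (Commute.refl y).inv_left
  simpa using this

end TrefoilPair

end TrefoilRelations

/-! ### Normal forms in the trefoil group. -/

/-- Letters of normal forms in the group generated by `w` and `y` with `w ^ 2 = y ^ 3`. -/
inductive TrefoilLetter
  | w | y | y2

namespace TrefoilLetter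

/-- The letter inverse to a given one up to the central element. -/
def mirror : TrefoilLetter → TrefoilLetter
  | w => w
  | y => y2
  | y2 => y

/-- The value of a letter in a group. -/
def val {G : Type*} [Group G] (a b : G) : TrefoilLetter → G
  | w => a
  | y => b
  | y2 => b ^ 2

end TrefoilLetter

/-- The pair `(k, u)` stands for `(w ^ 2) ^ k` times the product of the letters of `u`. -/
abbrev TrefoilWord := ℤ × List TrefoilLetter

namespace TrefoilWord

open TrefoilLetter

/-- Left multiplication by a letter. -/
def push : TrefoilLetter → TrefoilWord → TrefoilWord
  | x, (k, []) => (k, [x])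
  | .w, (k, .w :: u) => (k + 1, u)
  | .w, (k, .y :: u) => (k, .w :: .y :: u)
  | .w, (k, .y2 :: u) => (k, .w :: .y2 :: u)
  | .y, (k, .w :: u) => (k, .y :: .w :: u)
  | .y, (k, .y :: u) => (k, .y2 :: u)
  | .y, (k, .y2 :: u) => (k + 1, u)
  | .y2, (k, .w :: u) => (k, .y2 :: .w :: u)
  | .y2, (k, .y :: u) => (k + 1, u)
  | .y2, (k, .y2 :: u) => (k + 1, .y :: u)

/-- Product of two words. -/
def mul (a b : TrefoilWord) : TrefoilWord :=
  a.2.foldr push (a.1 + b.1, b.2)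

/-- Inverse of a word. -/
def inv (a : TrefoilWord) : TrefoilWord :=
  -- Each inverted letter is its mirror times the inverse of the central element, hence the length.
  (-a.1 - a.2.length, (a.2.map mirror).reverse)

/-- Conjugation by the last letter. -/
def rotate (a : TrefoilWord) : TrefoilWord :=
  match a.2.reverse with
  | [] => a
  | x :: r => push x (a.1, r.reverse)

/-- Some words that are not central in any torsion-free nonabelian quotient. -/
def noncentral : List TrefoilLetter → Bool
  | [.w, .y] | [.w, .y2] | [.w, .y, .w, .y] | [.w, .y, .w, .y2] | [.w, .y2, .w, .y2]
  | [.w, .y, .w, .y, .w, .y] | [.w, .y, .w, .y, .w, .y2] | [.w, .y2, .w, .y2, .w, .y]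
  | [.w, .y2, .w, .y2, .w, .y2] | [.w, .y, .w, .y, .w, .y, .w, .y]
  | [.w, .y, .w, .y, .w, .y, .w, .y2] | [.w, .y2, .w, .y2, .w, .y2, .w, .y]
  | [.w, .y2, .w, .y2, .w, .y2, .w, .y2] => true
  | _ => false

/-- `f u`, written so that kernel reduction evaluates `u` first. -/
def forceLetters {β : Type*} : List TrefoilLetter → (List TrefoilLetter → β) → β
  | [], f => f []
  | .w :: u, f => forceLetters u fun u => f (.w :: u)
  | .y :: u, f => forceLetters u fun u => f (.y :: u)
  | .y2 :: u, f => forceLetters u fun u => f (.y2 :: u)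

theorem forceLetters_eq {β : Type*} (u : List TrefoilLetter) (f : List TrefoilLetter → β) :
    forceLetters u f = f u := by
  induction u generalizing f with
  | nil => rfl
  | cons x u ih => cases x <;> simp [forceLetters, ih]

/-- `f a`, written so that kernel reduction evaluates the letters of `a` first. -/
def force {β : Type*} : TrefoilWord → (TrefoilWord → β) → β
  | (k, u), f => forceLetters u fun u => f (k, u)

theorem force_eq {β : Type*} (a : TrefoilWord) (f : TrefoilWord → β) : force a f = f a := by
  rw [force, forceLetters_eq]

/-- A sufficient criterion for a word to be nontrivial in every torsion-free nonabelian quotient;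
the first argument bounds the number of rotations. -/
def nontriv : ℕ → TrefoilWord → Bool
  | 0, _ => false
  | n + 1, (k, u) =>
    match u with
    | [] => k != 0
    | [_] => true
    | u => noncentral u || force (rotate (k, u)) (nontriv n)

/-- Sufficient criterion for two words to have different values. -/
def sep (a b : TrefoilWord) : Bool := force (mul a (inv b)) (nontriv 9)

section Eval

variable {G : Type*} [Group G] {w y : G}

/-- Value of a word in a group. -/
def eval (w y : G) (a : TrefoilWord) : G := (w ^ 2) ^ a.1 * (a.2.map (val w y)).prod

theorem val_mul_zpow (h : TrefoilPair w y) (x : TrefoilLetter) (k : ℤ) (g : G) :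
    val w y x * ((w ^ 2) ^ k * g) = (w ^ 2) ^ k * (val w y x * g) := by
  rw [← mul_assoc, ← ((h.central _).zpow_left k).eq, mul_assoc]

theorem eval_push (h : TrefoilPair w y) (x : TrefoilLetter) (a : TrefoilWord) :
    eval w y (push x a) = val w y x * eval w y a := by
  obtain ⟨k, u⟩ := a
  have hy3 : y * y ^ 2 = w ^ 2 := by rw [h.sq_eq_cube, ← pow_succ']
  have hy3' : y ^ 2 * y = w ^ 2 := by rw [h.sq_eq_cube, ← pow_succ]
  have hy4 : y ^ 2 * y ^ 2 = w ^ 2 * y := by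
    rw [h.sq_eq_cube, ← pow_add, ← pow_succ]
  have hyy : y * y = y ^ 2 := (pow_two y).symm
  have hww : w * w = w ^ 2 := (pow_two w).symm
  rw [show eval w y (k, u) = (w ^ 2) ^ k * (u.map (val w y)).prod from rfl, val_mul_zpow h]
  rcases u with _ | ⟨z, u⟩
  · cases x <;> simp [push, eval]
  · cases x <;> cases z <;> simp only [push, eval, List.map_cons, List.prod_cons, zpow_add_one,
      val, ← mul_assoc] <;> simp only [mul_assoc] <;> congr 1 <;> simp only [← mul_assoc, *]

theorem eval_mul (h : TrefoilPair w y) (a b : TrefoilWord) :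
    eval w y (mul a b) = eval w y a * eval w y b := by
  obtain ⟨k, u⟩ := a
  have : ∀ b : TrefoilWord, eval w y (u.foldr push b) = (u.map (val w y)).prod * eval w y b := by
    intro b
    induction u with
    | nil => simp
    | cons x u ih => rw [List.foldr_cons, eval_push h, ih]; simp [mul_assoc]
  rw [mul, this]
  simp only [eval, zpow_add]
  rw [← mul_assoc, ← mul_assoc, ← mul_assoc, ← ((h.central _).zpow_left k).eq]

theorem val_mirror (h : TrefoilPair w y) (x : TrefoilLetter) :
    val w y x.mirror = w ^ 2 * (val w y x)⁻¹ := by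
  cases x
  · simp [mirror, val, pow_two]
  · simp [mirror, val, h.sq_eq_cube, pow_succ]
  · simp [mirror, val, h.sq_eq_cube, pow_succ]

theorem eval_inv (h : TrefoilPair w y) (a : TrefoilWord) : eval w y (inv a) = (eval w y a)⁻¹ := by
  obtain ⟨k, u⟩ := a
  have : ((u.map mirror).reverse.map (val w y)).prod
      = (w ^ 2) ^ (u.length : ℤ) * ((u.map (val w y)).prod)⁻¹ := by
    induction u with
    | nil => simp
    | cons x u ih =>
      simp only [List.map_cons, List.reverse_cons, List.map_append, List.prod_append, ih,
        List.map_nil, List.prod_cons, List.prod_nil, mul_one, val_mirror h, mul_inv_rev,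
        List.length_cons, Nat.cast_add, Nat.cast_one, zpow_add_one]
      rw [← mul_assoc, mul_assoc _ _ (w ^ 2), ← (h.central _).eq]
      simp only [mul_assoc]
  rw [eval, inv]
  simp only [this]
  rw [← mul_assoc, ← zpow_add, eval, mul_inv_rev, ← zpow_neg, ← ((h.central _).zpow_left _).eq]
  congr 2; ring

theorem eval_rotate_eq_one_iff (h : TrefoilPair w y) (a : TrefoilWord) :
    eval w y (rotate a) = 1 ↔ eval w y a = 1 := by
  obtain ⟨k, u⟩ := a
  rcases List.eq_nil_or_concat u with rfl | ⟨u, x, rfl⟩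
  · simp [rotate]
  · have : rotate (k, u.concat x) = push x (k, u) := by simp [rotate]
    rw [this, eval_push h, mul_eq_one_iff_eq_inv']
    simp only [eval, List.concat_eq_append, List.map_append, List.prod_append, List.map_cons,
      List.map_nil, List.prod_cons, List.prod_nil, mul_one]
    rw [← mul_assoc, mul_eq_one_iff_eq_inv]

/-- Since `w y² = (w²)² w⁻¹ y⁻¹`, words dominated by `y2` reduce to the same statements for the pair
`w⁻¹, y⁻¹`. -/
theorem eval_ne_one_of_noncentral (h : TrefoilPair w y) (k : ℤ) {u : List TrefoilLetter}
    (hu : noncentral u = true) :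
    eval w y (k, u) ≠ 1 := by
  have hpos : ∀ g : G, (∀ n : ℤ, g ≠ (w ^ 2) ^ n) → (u.map (val w y)).prod = g →
      eval w y (k, u) ≠ 1 := by
    rintro g hg rfl hg'
    exact hg (-k) (by rw [zpow_neg]; exact eq_inv_of_mul_eq_one_right hg')
  have hneg : ∀ (m : ℤ) (g : G), (∀ n : ℤ, g ≠ (w⁻¹ ^ 2) ^ n) →
      (u.map (val w y)).prod = (w ^ 2) ^ m * g → eval w y (k, u) ≠ 1 := by
    intro m g hg hu hg'
    apply hg (k + m)
    rw [eval, hu, ← mul_assoc, ← zpow_add] at hg'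
    rw [inv_pow, inv_zpow]
    exact eq_inv_of_mul_eq_one_right hg'
  have hpow : ∀ m : ℕ, (w * y ^ 2) ^ m = (w ^ 2) ^ (2 * (m : ℤ)) * (w⁻¹ * y⁻¹) ^ m := by
    intro m
    have hwy2 : w * y ^ 2 = (w ^ 2) ^ (2 : ℤ) * (w⁻¹ * y⁻¹) := by
      calc w * y ^ 2 = w * (w ^ 2 * y⁻¹) := by rw [h.sq_eq_cube]; group
        _ = _ := by group
    rw [hwy2, ((h.central _).zpow_left _).mul_pow, zpow_mul, zpow_natCast]
  have hpow' : ∀ m : ℕ, (w * y ^ 2) ^ m * y⁻¹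
      = (w ^ 2) ^ (2 * (m : ℤ)) * ((w⁻¹ * y⁻¹) ^ m * y⁻¹) := by
    intro m; rw [hpow, mul_assoc]
  unfold noncentral at hu
  split at hu
  · exact hpos _ h.mul_ne (by simp [val])
  · exact hneg _ _ h.inv.mul_ne (by rw [← pow_one (w⁻¹ * y⁻¹), ← hpow 1]; simp [val])
  · exact hpos _ h.mul_pow_two_ne (by simp [val, pow_succ, mul_assoc])
  · exact hpos _ (h.mul_pow_mul_ne 2) (by simp [val, pow_succ, mul_assoc])
  · exact hneg _ _ h.inv.mul_pow_two_ne (by rw [← hpow 2]; simp [val, pow_succ, mul_assoc])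
  · exact hpos _ h.mul_pow_three_ne (by simp [val, pow_succ, mul_assoc])
  · exact hpos _ (h.mul_pow_mul_ne 3) (by simp [val, pow_succ, mul_assoc])
  · exact hneg _ _ (h.inv.mul_pow_mul_ne 3) (by rw [← hpow' 3]; simp [val, pow_succ, mul_assoc])
  · exact hneg _ _ h.inv.mul_pow_three_ne (by rw [← hpow 3]; simp [val, pow_succ, mul_assoc])
  · exact hpos _ h.mul_pow_four_ne (by simp [val, pow_succ, mul_assoc])
  · exact hpos _ (h.mul_pow_mul_ne 4) (by simp [val, pow_succ, mul_assoc])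
  · exact hneg _ _ (h.inv.mul_pow_mul_ne 4) (by rw [← hpow' 4]; simp [val, pow_succ, mul_assoc])
  · exact hneg _ _ h.inv.mul_pow_four_ne (by rw [← hpow 4]; simp [val, pow_succ, mul_assoc])
  · exact absurd hu (by simp)

theorem eval_ne_one_of_nontriv (h : TrefoilPair w y) (n : ℕ) (a : TrefoilWord)
    (ha : nontriv n a = true) :
    eval w y a ≠ 1 := by
  induction n generalizing a with
  | zero => simp [nontriv] at ha
  | succ n ih =>
    obtain ⟨k, u⟩ := a
    rcases u with _ | ⟨x, _ | ⟨z, u⟩⟩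
    · simp [nontriv] at ha
      simpa [eval] using h.zpow_ne_one ha
    · intro h1
      have h2 : val w y x = (w ^ 2) ^ (-k) := by
        rw [zpow_neg]; exact eq_inv_of_mul_eq_one_right (by simpa [eval] using h1)
      cases x
      · exact h.left_ne _ h2
      · exact h.right_ne _ h2
      · refine h.right_ne (1 + k) ?_
        change y ^ 2 = _ at h2
        rw [zpow_add, zpow_one, ← inv_inv ((w ^ 2) ^ k), ← zpow_neg, ← h2, h.sq_eq_cube]
        group
    · simp only [nontriv, force_eq, Bool.or_eq_true] at ha
      rcases ha with ha | ha
      · exact eval_ne_one_of_noncentral h k ha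
      · exact fun h1 => ih _ ha ((eval_rotate_eq_one_iff h _).2 h1)

theorem eval_ne_of_sep (h : TrefoilPair w y) {a b : TrefoilWord} (hab : sep a b = true) :
    eval w y a ≠ eval w y b := by
  rw [sep, force_eq] at hab
  have := eval_ne_one_of_nontriv h _ _ hab
  rwa [eval_mul h, eval_inv h, Ne, mul_inv_eq_one] at this

end Eval

end TrefoilWord

/-! ### Forcing new points by search. -/

section Search

variable {M : Type*} (force : M → (M → Bool) → Bool) (step : Fin 3 → Fin 3 → M → M)
  (sep : M → M → Bool) (root : M) (i : Fin 3)

/-- Whether both possible partners of the pair `c` differ from all points found so far. -/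
def feasible (pts : List M) (c : M × Fin 3) : Bool :=
  (c.2 != i || sep c.1 root) &&
    [0, 1, 2].all fun k => k == c.2 || force (step c.2 k c.1) fun q => pts.all (sep q)

/-- Whether `n` new points are forced, by repeatedly passing to the partners of a pair. -/
def search : ℕ → List M → Bool
  | 0, _ => true
  | n + 1, pts =>
    match (pts.flatMap fun d => [(d, 0), (d, 1), (d, 2)]).find?
        (feasible force step sep root i pts) with
    | none => false
    | some c => [0, 1, 2].all fun k => k == c.2 || force (step c.2 k c.1) fun q => search n (q :: pts)

variable {force step sep root i}

/-- Each round picks a nonexceptional pair whose two possible partners are both new. The true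
partner is one of them, and the search has succeeded in either branch. -/
theorem le_card_of_search {G : Type*} [Group G] {s : Fin 3 → G} {D : Finset G} {v : G}
    (h : AlmostCovered s D v i) {ev : M → G} (hforce : ∀ m f, force m f = f m)
    (hstep : ∀ j k m, ev (step j k m) = (s k)⁻¹ * s j * ev m)
    (hsep : ∀ a b, sep a b = true → ev a ≠ ev b) (hroot : ev root = 1) (n : ℕ) (pts : List M)
    (hs : search force step sep root i n pts = true) (hD : ∀ p ∈ pts, ev p * v ∈ D)
    (hnodup : (pts.map ev).Nodup) : n + pts.length ≤ D.card := by
  induction n generalizing pts with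
  | zero =>
    classical
    have h1 : ((pts.map ev).map (· * v)).Nodup := hnodup.map (mul_left_injective v)
    have h2 := List.toFinset_card_of_nodup h1
    rw [List.length_map, List.length_map] at h2
    rw [zero_add, ← h2]
    apply Finset.card_le_card
    intro x hx
    simp only [List.mem_toFinset, List.mem_map, exists_exists_and_eq_and] at hx
    obtain ⟨p, hp, rfl⟩ := hx
    exact hD p hp
  | succ n ih =>
    rw [search] at hs
    split at hs
    · exact absurd hs (by simp)
    · rename_i c hc
      have hfeas := List.find?_some hc
      have hmem := List.mem_of_find?_eq_some hc
      simp only [List.mem_flatMap, List.mem_cons, List.not_mem_nil, or_false] at hmem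
      have hc1 : c.1 ∈ pts := by
        obtain ⟨d, hd, rfl | rfl | rfl⟩ := hmem <;> exact hd
      have hall : ∀ k : Fin 3, k ∈ ([0, 1, 2] : List (Fin 3)) := by decide
      simp only [feasible, Bool.and_eq_true, Bool.or_eq_true, bne_iff_ne, List.all_eq_true,
        beq_iff_eq, hforce] at hfeas hs
      obtain ⟨k, hk, hkD⟩ := h.partner (ev c.1 * v) (hD _ hc1) c.2
        (hfeas.1.imp_right fun hr hv => hsep _ _ hr (by rw [hroot]; simpa using hv))
      have h1 := (hfeas.2 k (hall k)).resolve_left hk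
      have h2 := (hs k (hall k)).resolve_left hk
      have := ih _ h2 (by
        simp only [List.mem_cons, forall_eq_or_imp]
        refine ⟨?_, hD⟩
        rw [hstep, mul_assoc]; exact hkD) (by
        simp only [List.map_cons, List.nodup_cons, List.mem_map, not_exists, not_and]
        exact ⟨fun p hp hpe => hsep _ _ (h1 p hp) hpe.symm, hnodup⟩)
      simp only [List.length_cons] at this
      omega

end Search

/-! ### The search in trefoil quotients. -/

namespace TrefoilWord

open TrefoilLetter

/-- The transition from a point to its partner. -/
def stepOf (S : Fin 3 → TrefoilWord) (j k : Fin 3) (m : TrefoilWord) : TrefoilWord :=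
  mul (mul (inv (S k)) (S j)) m

/-- The triple `y, 1, w`. -/
def tripleA : Fin 3 → TrefoilWord
  | 0 => (0, [y])
  | 1 => (0, [])
  | 2 => (0, [w])

/-- The triple `1, y, w * y⁻¹`. -/
def tripleB : Fin 3 → TrefoilWord
  | 0 => (0, [])
  | 1 => (0, [y])
  | 2 => (-1, [w, y2])

theorem search_tripleA (i : Fin 3) :
    search force (stepOf tripleA) sep (0, []) i 8 [(0, [])] = true := by
  revert i
  decide +kernel

theorem search_tripleB (i : Fin 3) :
    search force (stepOf tripleB) sep (0, []) i 8 [(0, [])] = true := by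
  revert i
  decide +kernel

theorem le_card {G : Type*} [Group G] {s : Fin 3 → G} {D : Finset G} {v : G} {i : Fin 3}
    (h : AlmostCovered s D v i) {a b : G} (hab : TrefoilPair a b) {S : Fin 3 → TrefoilWord}
    (hS : ∀ j, s j = s 0 * (eval a b (S 0))⁻¹ * eval a b (S j))
    (hs : search force (stepOf S) sep (0, []) i 8 [(0, [])] = true) : 9 ≤ D.card := by
  refine le_card_of_search h (ev := eval a b) force_eq ?_ (fun _ _ => eval_ne_of_sep hab) ?_ 8 _
    hs ?_ ?_
  · intro j k m
    rw [stepOf, eval_mul hab, eval_mul hab, eval_inv hab, hS j, hS k]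
    group
  · simp [eval]
  · simpa [eval] using h.mem
  · simp

end TrefoilWord

theorem closure_pair_eq_top {G : Type*} [Group G] {a b t u : G}
    (h : Subgroup.closure {a, b} = ⊤) (ha : a ∈ Subgroup.closure {t, u})
    (hb : b ∈ Subgroup.closure {t, u}) : Subgroup.closure {t, u} = ⊤ := by
  rw [eq_top_iff, ← h, Subgroup.closure_le]
  rintro x (rfl | rfl)
  · exact ha
  · exact hb

theorem AlmostCovered.trefoilPair {G : Type*} [Group G] {s : Fin 3 → G} {D : Finset G} {v : G}
    {i : Fin 3} (hG : ∀ g : G, IsOfFinOrder g → g = 1) (h : AlmostCovered s D v i) {w y : G}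
    (hgen : Subgroup.closure {w, y} = ⊤) (hwy : w ^ 2 = y ^ 3) : TrefoilPair w y where
  torsionFree := hG
  sq_eq_cube := hwy
  central x := by
    have hx : x ∈ Subgroup.closure {w, y} := hgen ▸ Subgroup.mem_top x
    have : Subgroup.closure {w, y} ≤ Subgroup.centralizer {w ^ 2} := by
      rw [Subgroup.closure_le]
      rintro z (rfl | rfl)
      · exact Subgroup.mem_centralizer_singleton_iff.2 ((Commute.refl z).pow_right 2).eq
      · exact Subgroup.mem_centralizer_singleton_iff.2 (by
          rw [hwy]; exact ((Commute.refl z).pow_right 3).eq)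
    exact (Subgroup.mem_centralizer_singleton_iff.1 (this hx)).symm
  not_commute := h.not_commute hG hgen

/-! ### Alternating words and the list of short relations. -/

/-- Words in three letters stand for alternating products `(s a)⁻¹ * s b * (s c)⁻¹ * ⋯`. -/
abbrev PathWord := List (Fin 3)

namespace PathWord

/-- Left multiplication by a letter. -/
def push (x : Fin 3) : PathWord → PathWord
  | [] => [x]
  | z :: t => if x = z then t else x :: z :: t

/-- The transition from a point to its partner. -/
def step (j k : Fin 3) (m : PathWord) : PathWord := push k (push j m)

/-- `f u`, written so that kernel reduction evaluates `u` first. -/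
def force {β : Type*} : PathWord → (PathWord → β) → β
  | [], f => f []
  | 0 :: u, f => force u fun u => f (0 :: u)
  | 1 :: u, f => force u fun u => f (1 :: u)
  | 2 :: u, f => force u fun u => f (2 :: u)

theorem force_eq {β : Type*} (u : PathWord) (f : PathWord → β) : force u f = f u := by
  induction u generalizing f with
  | nil => rfl
  | cons x u ih => fin_cases x <;> simp [force, ih]

/-- The relation words that can hold in no almost covered configuration, up to symmetry. -/
def relations : List PathWord :=
  [[0, 1], [0, 1, 0, 1], [0, 1, 0, 2], [0, 1, 0, 1, 0, 1], [0, 1, 0, 1, 0, 2],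
    [0, 1, 0, 2, 1, 2], [0, 1, 2, 0, 1, 2], [0, 1, 0, 1, 0, 1, 0, 1], [0, 1, 0, 1, 0, 1, 0, 2],
    [0, 1, 0, 1, 0, 2, 0, 2], [0, 1, 0, 1, 0, 2, 1, 2], [0, 1, 0, 1, 2, 0, 1, 2],
    [0, 1, 0, 1, 2, 1, 0, 2], [0, 1, 0, 2, 0, 1, 0, 2], [0, 1, 0, 2, 0, 1, 2, 1],
    [0, 1, 0, 2, 1, 0, 1, 2], [0, 1, 0, 2, 1, 0, 2, 1]]

/-- The renaming of letters that sends `a, b` to `0, 1`. -/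
def recolor (a b x : Fin 3) : Fin 3 := if x = a then 0 else if x = b then 1 else 2

/-- Whether a word is a symmetric copy of one of `relations`; the first argument bounds the number
of rotations. -/
def excluded : ℕ → PathWord → Bool
  | 0, _ => false
  | n + 1, u =>
    match u with
    | a :: b :: t =>
      (a != b && relations.contains ((a :: b :: t).map (recolor a b))) ||
        -- Rotating by two letters keeps the alternation of inverted and plain factors, so it is a
        -- conjugation.
        excluded n (t.foldr push [a, b])
    | _ => false

/-- Sufficient criterion for two words to have different values. -/
def sep (a b : PathWord) : Bool :=
  a.length % 2 == 0 && b.length % 2 == 0 && force (a.foldr push b.reverse) fun u =>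
    u.length % 2 == 0 && u.length != 0 && decide (u.length ≤ 8) && decide (u.IsChain (· ≠ ·))

theorem search_path (i : Fin 3) : search force step sep [] i 8 [[]] = true := by
  revert i
  decide +kernel

theorem excluded_two : ∀ a b : Fin 3, [a, b].IsChain (· ≠ ·) →
    excluded 5 [a, b] = true ∨ excluded 5 [a, b].reverse = true := by
  decide +kernel

theorem excluded_four : ∀ a b c d : Fin 3, [a, b, c, d].IsChain (· ≠ ·) →
    excluded 5 [a, b, c, d] = true ∨ excluded 5 [a, b, c, d].reverse = true := by
  decide +kernel

theorem excluded_six : ∀ a b c d e f : Fin 3, [a, b, c, d, e, f].IsChain (· ≠ ·) →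
    excluded 6 [a, b, c, d, e, f] = true ∨ excluded 6 [a, b, c, d, e, f].reverse = true := by
  decide +kernel

theorem excluded_eight : ∀ a b c d e f g h : Fin 3, [a, b, c, d, e, f, g, h].IsChain (· ≠ ·) →
    excluded 8 [a, b, c, d, e, f, g, h] = true ∨
      excluded 8 [a, b, c, d, e, f, g, h].reverse = true := by
  decide +kernel

end PathWord

/-! ### Evaluation of alternating words and exclusion of the relations. -/

namespace PathWord

theorem bodd_eq_false {n : ℕ} (h : n % 2 = 0) : n.bodd = false := by
  rw [Nat.mod_two_of_bodd] at h
  simpa using h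

section Eval

variable {G : Type*} [Group G] (s : Fin 3 → G)

/-- Alternating product of a word; `true` means that the first factor is inverted. -/
def eval : Bool → PathWord → G
  | _, [] => 1
  | true, x :: t => (s x)⁻¹ * eval false t
  | false, x :: t => s x * eval true t

theorem eval_push (b : Bool) (x : Fin 3) (u : PathWord) :
    eval s b (push x u) = eval s b (x :: u) := by
  rcases u with _ | ⟨z, t⟩
  · rfl
  · rw [push]
    split_ifs with hx
    · subst hx; cases b <;> simp [eval]
    · rfl

theorem eval_append (b : Bool) (a u : PathWord) :
    eval s b (a ++ u) = eval s b a * eval s (b ^^ a.length.bodd) u := by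
  induction a generalizing b with
  | nil => simp [eval]
  | cons x t ih => cases b <;> simp [eval, ih, mul_assoc]

theorem eval_foldr_push (b : Bool) (a u : PathWord) :
    eval s b (a.foldr push u) = eval s b (a ++ u) := by
  induction a generalizing b with
  | nil => rfl
  | cons x t ih => rw [List.foldr_cons, eval_push]; cases b <;> simp [eval, ih]

theorem eval_reverse (b : Bool) (a : PathWord) :
    eval s (b ^^ a.length.bodd) a.reverse = (eval s b a)⁻¹ := by
  induction a generalizing b with
  | nil => simp [eval]
  | cons x t ih =>
    have h1 : (b ^^ (x :: t).length.bodd) = (!b ^^ t.length.bodd) := by simp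
    rw [h1, List.reverse_cons, eval_append, ih, List.length_reverse]
    cases b <;> cases t.length.bodd <;> simp [eval]

theorem bodd_length_foldr_push (a u : PathWord) :
    (a.foldr push u).length.bodd = (a ++ u).length.bodd := by
  induction a with
  | nil => rfl
  | cons x t ih =>
    have : ∀ r : PathWord, (push x r).length.bodd = !r.length.bodd := by
      intro r
      rcases r with _ | ⟨z, r⟩
      · simp [push]
      · rw [push]; split_ifs <;> simp
    rw [List.foldr_cons, this, ih]; simp

theorem eval_map (b : Bool) (σ : Fin 3 → Fin 3) (u : PathWord) :
    eval s b (u.map σ) = eval (s ∘ σ) b u := by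
  induction u generalizing b with
  | nil => simp [eval]
  | cons x t ih => cases b <;> simp [eval, ih]

theorem eval_step (j k : Fin 3) (m : PathWord) :
    eval s true (step j k m) = (s k)⁻¹ * s j * eval s true m := by
  rw [step, eval_push, eval, eval_push, eval, mul_assoc]

end Eval

theorem exists_perm_recolor : ∀ a b : Fin 3, a ≠ b →
    ∃ σ : Equiv.Perm (Fin 3), ∀ x, σ (recolor a b x) = x := by
  decide +kernel

section Configurations

variable {G : Type*} [Group G] {s : Fin 3 → G} {D : Finset G} {v : G} {i : Fin 3}

/-- The bound on `D` matters only for the two trefoil relations, which are not contradictory in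
themselves but force nine points. -/
theorem eval_ne_one_of_mem_relations (hG : ∀ g : G, IsOfFinOrder g → g = 1)
    (h : AlmostCovered s D v i) (hD : D.card < 9) {u : PathWord} (hu : u ∈ relations) :
    eval s true u ≠ 1 := by
  obtain ⟨y, hy⟩ : ∃ y, y = (s 0)⁻¹ * s 1 := ⟨_, rfl⟩
  obtain ⟨z, hz⟩ : ∃ z, z = (s 0)⁻¹ * s 2 := ⟨_, rfl⟩
  have hgen := h.closure_eq_top
  rw [← hy, ← hz] at hgen
  have hs1 : s 1 = s 0 * y := by rw [hy, mul_inv_cancel_left]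
  have hs2 : s 2 = s 0 * z := by rw [hz, mul_inv_cancel_left]
  have hncomm := h.not_commute hG hgen
  have hy1 : y ≠ 1 := by rintro rfl; exact hncomm (Commute.one_left z)
  have hyz1 : y * z ≠ 1 := by
    intro hyz
    rw [eq_inv_of_mul_eq_one_right hyz] at hncomm
    exact hncomm (Commute.refl y).inv_right
  have hymem : ∀ t a : G, y ∈ Subgroup.closure {t, a} → z ∈ Subgroup.closure {t, a} →
    Subgroup.closure {t, a} = ⊤ := fun t a h1 h2 => closure_pair_eq_top hgen h1 h2
  have hgen' : Subgroup.closure {z, y} = ⊤ := by rwa [Set.pair_comm]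
  intro h1
  simp only [relations, List.mem_cons, List.not_mem_nil, or_false] at hu
  rcases hu with rfl | rfl | rfl | rfl | rfl | rfl | rfl | rfl | rfl | rfl | rfl | rfl | rfl |
    rfl | rfl | rfl | rfl <;> simp [eval, hs1, hs2, mul_assoc] at h1
  · exact hy1 h1
  · exact hy1 (eq_one_of_pow_eq_one hG two_ne_zero (by rw [← h1, pow_two]))
  · exact hyz1 h1
  · exact hy1 (eq_one_of_pow_eq_one hG three_ne_zero (by rw [← h1, pow_succ', pow_two]))
  · refine hncomm ?_
    rw [show z = (y ^ 2)⁻¹ from eq_inv_of_mul_eq_one_right (by rw [← h1, pow_two, mul_assoc])]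
    exact ((Commute.refl y).pow_right 2).inv_right
  · refine h.conj_ne_zpow hG hgen (k := -1) (by decide) ?_
    calc y * z * y⁻¹ = y * (z * (y⁻¹ * z)) * z⁻¹ := by group
      _ = _ := by rw [h1]; group
  · refine hncomm ?_
    calc y * z = z * (y * (z⁻¹ * (y⁻¹ * z)))⁻¹ * y := by group
      _ = _ := by rw [h1]; group
  · exact hy1 (eq_one_of_pow_eq_one hG four_ne_zero (by
      rw [← h1, pow_succ', pow_succ', pow_two]))
  · refine hncomm ?_
    rw [show z = (y ^ 3)⁻¹ from eq_inv_of_mul_eq_one_right (by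
      rw [← h1, pow_succ', pow_two]; simp only [mul_assoc])]
    exact ((Commute.refl y).pow_right 3).inv_right
  -- The relation `y² z² = 1` is that of the Klein bottle group, in which `y` inverts `y z`.
  · refine h.conj_ne_zpow hG (hymem y (y * z) (Subgroup.subset_closure (by simp)) ?_) (k := -1)
      (by decide) ?_
    · rw [← inv_mul_cancel_left y z]
      exact Subgroup.mul_mem _ (Subgroup.inv_mem _ (Subgroup.subset_closure (by simp)))
        (Subgroup.subset_closure (by simp))
    · calc y * (y * z) * y⁻¹ = y * (y * (z * z)) * (y * z)⁻¹ := by group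
        _ = _ := by rw [h1]; group
  -- The relation `y² z y⁻¹ z = 1` says `(y⁻¹ z)² = (y⁻¹)³`. Up to a left factor, `s` becomes `y⁻¹,
  -- 1, y⁻¹ z`, which is `tripleA`.
  · have hgenA : Subgroup.closure {y⁻¹ * z, y⁻¹} = ⊤ := by
      have hmem : y ∈ Subgroup.closure {y⁻¹ * z, y⁻¹} := by
        rw [← inv_inv y]
        exact Subgroup.inv_mem _ (Subgroup.subset_closure (by simp))
      refine hymem _ _ hmem ?_
      have := Subgroup.mul_mem _ hmem
        (Subgroup.subset_closure (by simp) : y⁻¹ * z ∈ Subgroup.closure {y⁻¹ * z, y⁻¹})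
      rwa [mul_inv_cancel_left] at this
    have hp := h.trefoilPair hG hgenA (by
      calc (y⁻¹ * z) ^ 2 = y⁻¹ ^ 3 * (y * (y * (z * (y⁻¹ * z)))) := by
            simp only [pow_succ, pow_zero, one_mul]; group
        _ = _ := by rw [h1, mul_one])
    refine absurd (TrefoilWord.le_card h hp ?_ (TrefoilWord.search_tripleA i)) (by omega)
    intro j
    fin_cases j
    · simp [TrefoilWord.tripleA]
    · simp [TrefoilWord.tripleA, TrefoilWord.eval, TrefoilLetter.val, hs1]
    · simp [TrefoilWord.tripleA, TrefoilWord.eval, TrefoilLetter.val, hs2, mul_assoc]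
  · refine h.conj_ne_zpow hG (t := z⁻¹) (a := y) (hymem _ _ (Subgroup.subset_closure (by simp)) ?_)
      (k := 2) (by decide) ?_
    · rw [← inv_inv z]
      exact Subgroup.inv_mem _ (Subgroup.subset_closure (by simp))
    · calc z⁻¹ * y * z⁻¹⁻¹ = (y * (y * (z⁻¹ * (y⁻¹ * z))))⁻¹ * y ^ (2 : ℤ) := by group
        _ = _ := by rw [h1]; group
  · refine h.conj_ne_zpow hG (t := z⁻¹) (a := y) (hymem _ _ (Subgroup.subset_closure (by simp)) ?_)
      (k := -2) (by decide) ?_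
    · rw [← inv_inv z]
      exact Subgroup.inv_mem _ (Subgroup.subset_closure (by simp))
    · calc z⁻¹ * y * z⁻¹⁻¹ = y ^ (-2 : ℤ) * (y * (y * (z⁻¹ * (y * z)))) := by group
        _ = _ := by rw [h1, mul_one]
  · exact hyz1 (eq_one_of_pow_eq_one hG two_ne_zero (by rw [← h1, pow_two, mul_assoc]))
  · refine h.conj_ne_zpow hG hgen' (k := -2) (by decide) ?_
    calc z * y * z⁻¹ = y⁻¹ * (y * (z * (y * (z⁻¹ * y)))) * y⁻¹ := by group
      _ = _ := by rw [h1]; group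
  -- The relation `y z y⁻² z = 1` says `(z y)² = y³`. Up to a left factor, `s` is `1, y, (z y) y⁻¹`,
  -- which is `tripleB`.
  · have hgenB : Subgroup.closure {z * y, y} = ⊤ := by
      have hmem : y ∈ Subgroup.closure {z * y, y} := Subgroup.subset_closure (by simp)
      refine hymem _ _ hmem ?_
      have := Subgroup.mul_mem _
        (Subgroup.subset_closure (by simp) : z * y ∈ Subgroup.closure {z * y, y})
        (Subgroup.inv_mem _ hmem)
      rwa [mul_inv_cancel_right] at this
    have hp := h.trefoilPair hG hgenB (by
      calc (z * y) ^ 2 = z * (y * (z * (y⁻¹ * (y⁻¹ * z)))) * z⁻¹ * y ^ 3 := by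
            simp only [pow_succ, pow_zero, one_mul]; group
        _ = _ := by rw [h1]; group)
    refine absurd (TrefoilWord.le_card h hp ?_ (TrefoilWord.search_tripleB i)) (by omega)
    intro j
    fin_cases j
    · simp [TrefoilWord.tripleB]
    · simp [TrefoilWord.tripleB, TrefoilWord.eval, TrefoilLetter.val, hs1]
    · have : ((z * y) ^ 2)⁻¹ * (z * y * y ^ 2) = z := by
        calc ((z * y) ^ 2)⁻¹ * (z * y * y ^ 2) = (z * y)⁻¹ * y ^ 3 * y⁻¹ := by
              simp only [pow_succ, pow_zero, one_mul]; group
          _ = _ := by rw [← hp.sq_eq_cube]; simp only [pow_succ, pow_zero, one_mul]; group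
      simp [TrefoilWord.tripleB, TrefoilWord.eval, TrefoilLetter.val, hs2, this]
  · refine h.conj_ne_zpow hG hgen' (k := 2) (by decide) ?_
    calc z * y * z⁻¹ = y * (y * (z * (y⁻¹ * (z⁻¹ * y))))⁻¹ * y := by group
      _ = _ := by rw [h1, inv_one, mul_one, zpow_two]

theorem eval_ne_one_of_excluded (hG : ∀ g : G, IsOfFinOrder g → g = 1)
    (h : AlmostCovered s D v i) (hD : D.card < 9) (n : ℕ) (u : PathWord)
    (heven : u.length.bodd = false) (hu : excluded n u = true) : eval s true u ≠ 1 := by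
  induction n generalizing u with
  | zero => simp [excluded] at hu
  | succ n ih =>
    rcases u with _ | ⟨a, _ | ⟨b, t⟩⟩
    · simp [excluded] at hu
    · simp [excluded] at hu
    · simp only [excluded, Bool.or_eq_true, Bool.and_eq_true, bne_iff_ne, ne_eq,
        List.contains_iff_mem] at hu
      rcases hu with ⟨hab, hu⟩ | hu
      · obtain ⟨σ, hσ⟩ := exists_perm_recolor a b hab
        have := eval_ne_one_of_mem_relations hG (h.comp_perm σ) hD hu
        rwa [← eval_map, List.map_map, show σ ∘ recolor a b = id from funext hσ, List.map_id]
          at this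
      · have ht : t.length.bodd = false := by simpa using heven
        have := ih _ (by rw [bodd_length_foldr_push]; simp [ht]) hu
        rw [eval_foldr_push, eval_append, ht, Bool.xor_false, Ne, mul_eq_one_iff_inv_eq] at this
        intro h1
        apply this
        rw [show a :: b :: t = [a, b] ++ t from rfl, eval_append, mul_eq_one_iff_eq_inv] at h1
        simpa using h1.symm

theorem eval_ne_one (hG : ∀ g : G, IsOfFinOrder g → g = 1)
    (h : AlmostCovered s D v i) (hD : D.card < 9) (u : PathWord) (hu : u.IsChain (· ≠ ·))
    (heven : u.length % 2 = 0) (h0 : u.length ≠ 0) (h8 : u.length ≤ 8) : eval s true u ≠ 1 := by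
  have hb := bodd_eq_false heven
  have hrev : ∀ n, excluded n u = true ∨ excluded n u.reverse = true → eval s true u ≠ 1 := by
    rintro n (hu | hu)
    · exact eval_ne_one_of_excluded hG h hD n u hb hu
    · have := eval_ne_one_of_excluded hG h hD n _ (by rwa [List.length_reverse]) hu
      have hr := eval_reverse s true u
      rw [hb, Bool.xor_false] at hr
      rwa [hr, Ne, inv_eq_one] at this
  have hcases : u.length = 2 ∨ u.length = 4 ∨ u.length = 6 ∨ u.length = 8 := by omega
  rcases hcases with hl | hl | hl | hl
  · obtain ⟨a, b, rfl⟩ := List.length_eq_two.1 hl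
    exact hrev _ (excluded_two a b hu)
  · match u, hl with
    | [a, b, c, d], _ => exact hrev _ (excluded_four a b c d hu)
  · match u, hl with
    | [a, b, c, d, e, f], _ => exact hrev _ (excluded_six a b c d e f hu)
  · match u, hl with
    | [a, b, c, d, e, f, g, k], _ => exact hrev _ (excluded_eight a b c d e f g k hu)

theorem eval_ne_of_sep (hG : ∀ g : G, IsOfFinOrder g → g = 1)
    (h : AlmostCovered s D v i) (hD : D.card < 9) (a b : PathWord) (hab : sep a b = true) :
    eval s true a ≠ eval s true b := by
  simp only [sep, force_eq, Bool.and_eq_true, beq_iff_eq, bne_iff_ne, decide_eq_true_eq] at hab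
  obtain ⟨⟨ha, hb⟩, ⟨⟨he, h0⟩, h8⟩, hc⟩ := hab
  have := eval_ne_one hG h hD _ hc he h0 h8
  have hr := eval_reverse s true b
  rw [bodd_eq_false hb, Bool.xor_false] at hr
  rwa [eval_foldr_push, eval_append, bodd_eq_false ha, Bool.xor_false, hr, Ne, mul_inv_eq_one]
    at this

end Configurations

end PathWord

/-! ### The bound for configurations and for the group algebra. -/

theorem AlmostCovered.nine_le_card {G : Type*} [Group G] {s : Fin 3 → G} {D : Finset G} {v : G}
    {i : Fin 3} (hG : ∀ g : G, IsOfFinOrder g → g = 1) (h : AlmostCovered s D v i) :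
    9 ≤ D.card := by
  by_contra! hD
  have := le_card_of_search h (ev := PathWord.eval s true) PathWord.force_eq
    (PathWord.eval_step s) (PathWord.eval_ne_of_sep hG h hD) rfl 8 _ (PathWord.search_path i)
    (by simpa [PathWord.eval] using h.mem) (by simp)
  simp at this
  omega

theorem mainTheorem3 {F : Type*} [Field F] {G : Type*} [Group G]
    (hG : ∀ g : G, IsOfFinOrder g → g = 1)
    (γ δ : MonoidAlgebra F G)
    (hγ : γ.coeff.support.card = 3) (hγδ : γ * δ = 1) :
    9 ≤ δ.coeff.support.card := by
  classical
  let e := (γ.coeff.support.equivFinOfCardEq hγ).symm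
  let s : Fin 3 → G := fun j => (e j : G)
  have hs : Function.Injective s := Subtype.val_injective.comp e.injective
  have hsmem : ∀ j, γ.coeff (s j) ≠ 0 := fun j => Finsupp.mem_support_iff.1 (e j).2
  have hmul : ∀ g, (γ * δ).coeff g = ∑ j, γ.coeff (s j) * δ.coeff ((s j)⁻¹ * g) := by
    intro g
    rw [MonoidAlgebra.coeff_mul_apply_left, Finsupp.sum, ← Finset.sum_coe_sort]
    exact (Equiv.sum_comp e fun x => γ.coeff x * δ.coeff ((x : G)⁻¹ * g)).symm
  set D := δ.coeff.support with hDdef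
  have hpair : ∀ d ∈ D, ∀ j, s j * d ≠ 1 → ∃ k, k ≠ j ∧ (s k)⁻¹ * s j * d ∈ D := by
    intro d hd j hne
    by_contra! hcon
    have h0 : (γ * δ).coeff (s j * d) = 0 := by
      rw [hγδ, MonoidAlgebra.one_def, MonoidAlgebra.coeff_single, Finsupp.single_apply,
        if_neg (Ne.symm hne)]
    rw [hmul, Finset.sum_eq_single j] at h0
    · rw [inv_mul_cancel_left] at h0
      exact mul_ne_zero (hsmem j) (Finsupp.mem_support_iff.1 hd) h0
    · intro k _ hk
      have := hcon k hk
      rw [hDdef, Finsupp.notMem_support_iff, mul_assoc] at this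
      rw [this, mul_zero]
    · simp
  have hone : (γ * δ).coeff 1 ≠ 0 := by
    rw [hγδ, MonoidAlgebra.one_def, MonoidAlgebra.coeff_single]; simp
  rw [hmul] at hone
  obtain ⟨i, -, hi⟩ := Finset.exists_ne_zero_of_sum_ne_zero hone
  have hv : (s i)⁻¹ ∈ D := by
    rw [hDdef, Finsupp.mem_support_iff]
    simpa using right_ne_zero_of_mul hi
  obtain ⟨H, s', D', v', hcov, hcard⟩ := exists_almostCovered hs (v := (s i)⁻¹) (i := i) hv (by
    intro d hd j hj
    by_cases h1 : s j * d = 1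
    -- Any other pair with product 1 has `(i, (s i)⁻¹)` itself as partner; no cancellation is
    -- needed.
    · refine ⟨i, ?_, by rwa [mul_assoc, h1, mul_one]⟩
      rintro rfl
      exact hj.elim (fun h => h rfl) fun h => h (eq_inv_of_mul_eq_one_right h1)
    · exact hpair d hd j h1)
  refine (hcov.nine_le_card fun g hg => ?_).trans hcard
  exact Subtype.ext (hG g (H.subtype.isOfFinOrder hg))
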